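/- Let $X$ be an arbitrary topological space and let $\mathcal U=\{U_a\}_{a\in A}$ be an open cover of $X$, indexed by an arbitrary set $A$ (repetitions $U_a=U_{a'}$ with $a\neq a'$ are allowed). The \v{C}ech complex $\check C(\mathcal U)_*$ is the simplicial space whose $n$-th level is the disjoint union $$\check C(\mathcal U)_n=\coprod_{(a_0,\dots,a_n)\in A^{n+1}} U_{a_0\cdots a_n},\qquad U_{a_0\cdots a_n}=U_{a_0}\cap\dots\cap U_{a_n},$$ where a monotone map $\theta\colon[m]\to[n]$ acts by the inclusions $U_{a_0\cdots a_n}\subseteq U_{a_{\theta(0)}\cdots a_{\theta(m)}}$ (so faces omit indices and degeneracies repeat them). Its geometric realization is the quotient space $$|\check C(\mathcal U)_*|=\Bigl(\coprod_{n\ge 0}\check C(\mathcal U)_n\times\Delta^n\Bigr)\Big/\bigl((\theta^*x,t)\sim(x,\theta_*t)\bigr)$$ with the quotient topology in the category of all topological spaces, where $\Delta^n=\{t\in\mathbb R^{n+1}: 0\le t_i\le 1,\ \sum_i t_i=1\}$. Then the natural map $$\pi\colon|\check C(\mathcal U)_*|\to X,\qquad [(x,t)]\mapsto x,$$ is a weak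 equivalence: it induces a bijection on sets of path components and, for every $n\ge 1$ and every base point $p\in|\check C(\mathcal U)_*|$, an isomorphism $\pi_n(|\check C(\mathcal U)_*|,p)\to\pi_n(X,\pi(p))$. -/

import Mathlib

open CategoryTheory Opposite Topology

universe u v w

noncomputable section

/-! ### Weak homotopy equivalences -/

section WeakEquivalence

variable {X : Type u} {Y : Type v} [TopologicalSpace X] [TopologicalSpace Y]

/-- The map on sets of path components induced by a continuous map. -/
def pathComponentsMap (f : C(X, Y)) : ZerothHomotopy X → ZerothHomotopy Y :=
  ZerothHomotopy.lift (fun x => ZerothHomotopy.mk (f x))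
    (fun _ _ p => ZerothHomotopy.sound (p.map f.continuous))

/-- The composite of an `n`-dimensional loop based at `x` with a continuous map `f`. -/
def genLoopMap (f : C(X, Y)) (n : ℕ) (x : X) (p : GenLoop (Fin n) X x) :
    GenLoop (Fin n) Y (f x) :=
  ⟨f.comp p.1, fun y hy => congrArg f (p.2 y hy)⟩

/-- The map `π_n(X, x) → π_n(Y, f(x))` induced by a continuous map `f`. -/
def homotopyGroupMap (f : C(X, Y)) (n : ℕ) (x : X) :
    HomotopyGroup.Pi n X x → HomotopyGroup.Pi n Y (f x) :=
  Quotient.map (genLoopMap f n x) (fun _ _ h => h.comp_continuousMap f)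

/-- A continuous map is a weak equivalence if it induces a bijection on path components and
a bijection (hence an isomorphism of groups) on all homotopy groups at all base points of the
source. -/
def IsWeakEquivalence (f : C(X, Y)) : Prop :=
  Function.Bijective (pathComponentsMap f) ∧
    ∀ (n : ℕ), 1 ≤ n → ∀ x : X, Function.Bijective (homotopyGroupMap f n x)

end WeakEquivalence

/-! ### Geometric realization of a simplicial space -/

section Realization

/-- The disjoint union of the spaces `S_n × Δ^n`, where
`Δ^n = {t ∈ ℝ^{n+1} | 0 ≤ t_i, ∑ t_i = 1}`. -/
abbrev PreRealization (S : SimplicialObject TopCat.{w}) : Type w :=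
  Σ n : SimplexCategory, S.obj (op n) × stdSimplex ℝ (Fin (n.len + 1))

/-- The identifications `(θ^* x, t) ∼ (x, θ_* t)` for a monotone map `θ : [m] → [n]`,
`x ∈ S_n` and `t ∈ Δ^m`; here `θ_* : Δ^m → Δ^n` is the affine map given by `θ` on vertices. -/
inductive RealizationRel (S : SimplicialObject TopCat.{w}) :
    PreRealization S → PreRealization S → Prop
  | glue {m n : SimplexCategory} (θ : m ⟶ n) (x : S.obj (op n))
      (t : stdSimplex ℝ (Fin (m.len + 1))) :
      RealizationRel S ⟨m, ((S.map θ.op).hom x, t)⟩ ⟨n, (x, stdSimplex.map θ.toOrderHom t)⟩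

/-- The geometric realization of a simplicial space: the quotient of `∐ S_n × Δ^n` by the
equivalence relation generated by `RealizationRel`, with the quotient topology. -/
def Realization (S : SimplicialObject TopCat.{w}) : Type w :=
  Quot (RealizationRel S)

instance (S : SimplicialObject TopCat.{w}) : TopologicalSpace (Realization S) :=
  inferInstanceAs (TopologicalSpace (Quot (RealizationRel S)))

end Realization

/-! ### The Čech complex of a family of subsets -/

section Cech

variable {X : Type u} [TopologicalSpace X] {A : Type v}

/-- The `n`-th level of the Čech complex: the disjoint union of the subspaces
`U_{a_0 ⋯ a_n} = U_{a_0} ∩ ⋯ ∩ U_{a_n}` of `X` over all tuples `(a_0, …, a_n)` of indices. -/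
abbrev CechLevel (U : A → Set X) (n : SimplexCategory) : Type (max u v) :=
  Σ a : Fin (n.len + 1) → A, (⋂ i, U (a i) : Set X)

/-- The structure map of the Čech complex given by a monotone map `θ : [m] → [n]`: it reindexes
tuples along `θ` and includes `U_{a_0 ⋯ a_n}` in `U_{a_{θ(0)} ⋯ a_{θ(m)}}`. Thus faces omit
indices and degeneracies repeat them. -/
def cechLevelMap (U : A → Set X) {m n : SimplexCategory} (θ : m ⟶ n) :
    C(CechLevel U n, CechLevel U m) where
  toFun p := ⟨p.1 ∘ θ.toOrderHom,
    ⟨p.2.1, Set.mem_iInter.2 fun i => Set.mem_iInter.1 p.2.2 (θ.toOrderHom i)⟩⟩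
  continuous_toFun := continuous_sigma fun a =>
    (continuous_sigmaMk (σ := fun b : Fin (m.len + 1) → A => (⋂ i, U (b i) : Set X))
      (i := a ∘ θ.toOrderHom)).comp
      (continuous_subtype_val.subtype_mk
        (fun x : (⋂ i, U (a i) : Set X) =>
          Set.mem_iInter.2 fun i => Set.mem_iInter.1 x.2 (θ.toOrderHom i)))

/-- The Čech complex of a family of subsets of `X`, as a simplicial space. -/
def cechComplex (U : A → Set X) : SimplicialObject TopCat.{max u v} where
  obj n := TopCat.of (CechLevel U n.unop)
  map θ := TopCat.ofHom (cechLevelMap U θ.unop)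
  map_id _ := TopCat.hom_ext (ContinuousMap.ext fun _ => rfl)
  map_comp _ _ := TopCat.hom_ext (ContinuousMap.ext fun _ => rfl)

/-- The natural map from the realization of the Čech complex to `X`, sending the class of
`(x, t)`, with `x ∈ U_{a_0 ⋯ a_n}` and `t ∈ Δ^n`, to `x`. -/
def cechProjection (U : A → Set X) : C(Realization (cechComplex U), X) where
  toFun := Quot.lift
    (fun p : PreRealization (cechComplex U) => ((p.2.1 : CechLevel U p.1).2 : X))
    (by rintro _ _ ⟨θ, x, t⟩; rfl)
  continuous_toFun := continuous_quot_lift _ <| continuous_sigma fun n =>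
    (continuous_sigma fun _ => continuous_subtype_val :
      Continuous fun q : CechLevel U n => (q.2 : X)).comp continuous_fst

end Cech

end

noncomputable section

/-! ### Locally shrinkable maps are weak equivalences -/

section Shrinkable

open Set Filter unitInterval

variable {E X : Type*} [TopologicalSpace E] [TopologicalSpace X]

/-! Over a single member `U a` the projection is shrinkable: prepending `a` to every index tuple
cones each simplex off to a new vertex `a`, and sliding along the cone lines contracts the part of
the realization over `U a` fibrewise onto the section "vertex `a`"
(`isShrinkableOver_cechProjection`). No partition of unity on `X` is needed.

The rest uses only local shrinkability of `p`. A lift of a map `g` from a compact Hausdorff `K`,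
given near a closed set, extends over one more small closed piece by dragging it along the shrinking
homotopy until it becomes `s ∘ g` (`IsShrinkableOver.exists_extend_lift`). Compactness then gives a
global lift (`exists_lift_of_locally_shrinkable`). Applied to intervals, cubes and cubes times `I`,
this yields injectivity on path components and bijectivity on homotopy groups. Since lifts must be
prescribed on a neighbourhood of the closed set, loops and homotopies are first stretched to be
constant near the boundary. -/

/-- A map `p : E → X` is shrinkable over `W` if over `W` it has a continuous section `s` and
a continuous homotopy `H` over `W` from the identity to `s ∘ p`. -/
def IsShrinkableOver (p : E → X) (W : Set X) : Prop :=
  ∃ (s : X → E) (H : E × I → E), ContinuousOn s W ∧ ContinuousOn H ((p ⁻¹' W) ×ˢ univ) ∧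
    (∀ x ∈ W, p (s x) = x) ∧ (∀ e t, p e ∈ W → p (H (e, t)) = p e) ∧
    (∀ e, p e ∈ W → H (e, 0) = e) ∧ ∀ e, p e ∈ W → H (e, 1) = s (p e)

/-- A lift defined near a closed set `C` extends over a further closed set `D` that is mapped
into an open set over which `p` is shrinkable, without changing the lift on `C`. -/
theorem IsShrinkableOver.exists_extend_lift {p : E → X} {W : Set X} (hW : IsShrinkableOver p W)
    {K : Type*} [TopologicalSpace K] [NormalSpace K] {g : K → X} (hg : Continuous g)
    {D O : Set K} (hO : IsOpen O) (hDO : D ⊆ O) (hOW : MapsTo g O W)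
    {f : K → E} {V C : Set K} (hV : IsOpen V) (hC : IsClosed C) (hCV : C ⊆ V)
    (hf : ContinuousOn f V) (hpf : ∀ k ∈ V, p (f k) = g k) :
    ∃ (f' : K → E) (V' : Set K), IsOpen V' ∧ C ∪ D ⊆ V' ∧ ContinuousOn f' V' ∧
      (∀ k ∈ V', p (f' k) = g k) ∧ EqOn f' f C := by
  classical
  obtain ⟨s, H, hs, hH, hps, hpH, hH0, hH1⟩ := hW
  obtain ⟨V₂, hV₂, hCV₂, hV₂V⟩ := normal_exists_closure_subset hC hV hCV
  obtain ⟨V₁, hV₁, hCV₁, hV₁V₂⟩ := normal_exists_closure_subset hC hV₂ hCV₂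
  have hV₁V : V₁ ⊆ V := subset_closure.trans (hV₁V₂.trans (subset_closure.trans hV₂V))
  obtain ⟨φ, hφ0, hφ1, hφ⟩ := exists_continuous_zero_one_of_isClosed isClosed_closure
    hV₂.isClosed_compl (disjoint_compl_right_iff_subset.2 hV₁V₂)
  let ψ : K → I := fun k => ⟨φ k, hφ k⟩
  have hψ : Continuous ψ := φ.continuous.subtype_mk _
  have hψ0 : ∀ k ∈ V₁, ψ k = 0 := fun k hk => Subtype.ext (hφ0 (subset_closure hk))
  have hψ1 : ∀ k ∉ V₂, ψ k = 1 := fun k hk => Subtype.ext (hφ1 hk)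
  -- On `V₁` the lift stays untouched, because outside `O` the homotopy `H` is not available. Inside
  -- `O` the cutoff `ψ` moves it from `f` (`ψ = 0`) to `s ∘ g` (`ψ = 1`), which no longer needs `f`.
  let F : K → E := fun k =>
    if k ∈ V₁ then f k else if k ∈ V then H (f k, ψ k) else s (g k)
  have F1 : ∀ k ∈ V₁, F k = f k := fun k hk => if_pos hk
  have F2 : ∀ k ∈ O ∩ V, F k = H (f k, ψ k) := by
    rintro k ⟨hkO, hkV⟩
    by_cases hk : k ∈ V₁
    · rw [F1 k hk, hψ0 k hk, hH0]
      rw [hpf k hkV]; exact hOW hkO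
    · simp [F, hk, hkV]
  have F3 : ∀ k ∈ O ∩ (closure V₂)ᶜ, F k = s (g k) := by
    rintro k ⟨hkO, hk⟩
    have hk₂ : k ∉ V₂ := fun h => hk (subset_closure h)
    have hk₁ : k ∉ V₁ := fun h => hk₂ (hV₁V₂ (subset_closure h))
    by_cases hkV : k ∈ V
    · rw [F2 k ⟨hkO, hkV⟩, hψ1 k hk₂, hH1, hpf k hkV]
      rw [hpf k hkV]; exact hOW hkO
    · simp [F, hk₁, hkV]
  have hcases : ∀ k, k ∈ V ∨ k ∈ (closure V₂)ᶜ := fun k => by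
    by_cases hk : k ∈ V
    · exact .inl hk
    · exact .inr fun h => hk (hV₂V h)
  refine ⟨F, V₁ ∪ O, hV₁.union hO, union_subset_union hCV₁ hDO, ?_, ?_,
    fun k hk => F1 k (hCV₁ hk)⟩
  · intro k hk
    apply ContinuousAt.continuousWithinAt
    rcases hk with hk | hkO
    · exact (hf.continuousAt (hV.mem_nhds (hV₁V hk))).congr
        (eventually_of_mem (hV₁.mem_nhds hk) fun k hk => (F1 k hk).symm)
    · rcases hcases k with hk | hk
      · have hOV := (hO.inter hV)
        have : ContinuousOn (fun k => H (f k, ψ k)) (O ∩ V) :=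
          hH.comp ((hf.mono inter_subset_right).prodMk hψ.continuousOn)
            fun k hk => ⟨by rw [mem_preimage, hpf k hk.2]; exact hOW hk.1, mem_univ _⟩
        exact (this.continuousAt (hOV.mem_nhds ⟨hkO, hk⟩)).congr
          (eventually_of_mem (hOV.mem_nhds ⟨hkO, hk⟩) fun k hk => (F2 k hk).symm)
      · have hOV := (hO.inter (isClosed_closure (s := V₂)).isOpen_compl)
        have : ContinuousOn (fun k => s (g k)) (O ∩ (closure V₂)ᶜ) :=
          hs.comp hg.continuousOn fun k hk => hOW hk.1
        exact (this.continuousAt (hOV.mem_nhds ⟨hkO, hk⟩)).congr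
          (eventually_of_mem (hOV.mem_nhds ⟨hkO, hk⟩) fun k hk => (F3 k hk).symm)
  · rintro k (hk | hkO)
    · rw [F1 k hk, hpf k (hV₁V hk)]
    · rcases hcases k with hk | hk
      · have h := hpf k hk
        rw [F2 k ⟨hkO, hk⟩, hpH _ _ (by rw [h]; exact hOW hkO), h]
      · rw [F3 k ⟨hkO, hk⟩, hps _ (hOW hkO)]

/-- Every map from a compact Hausdorff space to the base of a locally shrinkable map lifts,
extending a given lift near a closed subset. -/
theorem exists_lift_of_locally_shrinkable {p : E → X}
    (hp : ∀ x, ∃ W, IsOpen W ∧ x ∈ W ∧ IsShrinkableOver p W)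
    {K : Type*} [TopologicalSpace K] [CompactSpace K] [T2Space K] {g : K → X} (hg : Continuous g)
    {f : K → E} {V C : Set K} (hV : IsOpen V) (hC : IsClosed C) (hCV : C ⊆ V)
    (hf : ContinuousOn f V) (hpf : ∀ k ∈ V, p (f k) = g k) :
    ∃ h : C(K, E), (∀ k, p (h k) = g k) ∧ EqOn h f C := by
  -- Quantifying over all initial lifts lets the union step chain two extensions; carrying a closed
  -- `C'` inside the open `V'` leaves room for the next one.
  have key : ∀ (f : K → E) (V C : Set K), IsOpen V → IsClosed C → C ⊆ V → ContinuousOn f V →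
      (∀ k ∈ V, p (f k) = g k) → ∃ (f' : K → E) (V' C' : Set K), IsOpen V' ∧ IsClosed C' ∧
        C' ⊆ V' ∧ C ⊆ C' ∧ univ ⊆ C' ∧ ContinuousOn f' V' ∧ (∀ k ∈ V', p (f' k) = g k) ∧
        EqOn f' f C := by
    refine isCompact_univ.induction_on (p := fun S : Set K =>
      ∀ (f : K → E) (V C : Set K), IsOpen V → IsClosed C → C ⊆ V → ContinuousOn f V →
      (∀ k ∈ V, p (f k) = g k) → ∃ (f' : K → E) (V' C' : Set K), IsOpen V' ∧ IsClosed C' ∧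
        C' ⊆ V' ∧ C ⊆ C' ∧ S ⊆ C' ∧ ContinuousOn f' V' ∧ (∀ k ∈ V', p (f' k) = g k) ∧
        EqOn f' f C) ?_ ?_ ?_ ?_
    · intro f V C hV hC hCV hf hpf
      exact ⟨f, V, C, hV, hC, hCV, Subset.rfl, empty_subset _, hf, hpf, fun _ _ => rfl⟩
    · intro S T hST hT f V C hV hC hCV hf hpf
      obtain ⟨f', V', C', h1, h2, h3, h4, h5, h6⟩ := hT f V C hV hC hCV hf hpf
      exact ⟨f', V', C', h1, h2, h3, h4, hST.trans h5, h6⟩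
    · intro S T hS hT f V C hV hC hCV hf hpf
      obtain ⟨f', V', C', h1, h2, h3, h4, h5, h6, h7, h8⟩ := hS f V C hV hC hCV hf hpf
      obtain ⟨f'', V'', C'', k1, k2, k3, k4, k5, k6, k7, k8⟩ := hT f' V' C' h1 h2 h3 h6 h7
      exact ⟨f'', V'', C'', k1, k2, k3, h4.trans k4, union_subset (h5.trans k4) k5, k6, k7,
        fun k hk => (k8 (h4 hk)).trans (h8 hk)⟩
    · intro k _
      obtain ⟨W, hWo, hkW, hW⟩ := hp (g k)
      have hO : IsOpen (g ⁻¹' W) := hWo.preimage hg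
      obtain ⟨D, hDk, hD, hDO⟩ := exists_mem_nhds_isClosed_subset (hO.mem_nhds hkW)
      refine ⟨D, mem_nhdsWithin_of_mem_nhds hDk, fun f V C hV hC hCV hf hpf => ?_⟩
      obtain ⟨f', V', h1, h2, h3, h4, h5⟩ :=
        hW.exists_extend_lift hg hO hDO (mapsTo_preimage g W) hV hC hCV hf hpf
      exact ⟨f', V', C ∪ D, h1, hC.union hD, h2, subset_union_left, subset_union_right, h3, h4,
        h5⟩
  obtain ⟨f', V', C', -, -, h1, -, h2, h3, h4, h5⟩ := key f V C hV hC hCV hf hpf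
  have hV' : V' = univ := univ_subset_iff.1 (h2.trans h1)
  subst hV'
  exact ⟨⟨f', continuousOn_univ.1 h3⟩, fun k => h4 k (mem_univ k), h5⟩

/-! ### Making maps on cubes constant near the boundary -/

/-- The homotopy `(s, t) ↦ max 0 (min 1 ((1 + 2 s) t - s))` from the identity of the unit
interval to a map that is constant near each end point. -/
def stretch : C(I × I, I) where
  toFun z := projIcc 0 1 zero_le_one ((1 + 2 * (z.1 : ℝ)) * z.2 - z.1)
  continuous_toFun := continuous_projIcc.comp (by fun_prop)

theorem stretch_zero (t : I) : stretch (0, t) = t := by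
  simp [stretch]

theorem stretch_apply_zero (s : I) : stretch (s, 0) = 0 :=
  projIcc_of_le_left zero_le_one (by simpa using s.2.1)

theorem stretch_apply_one (s : I) : stretch (s, 1) = 1 :=
  projIcc_of_right_le zero_le_one (by have := s.2.1; simp; linarith)

theorem stretch_one_of_lt {t : I} (ht : (t : ℝ) < 1 / 3) : stretch (1, t) = 0 :=
  projIcc_of_le_left zero_le_one (by simp; linarith)

theorem stretch_one_of_gt {t : I} (ht : 2 / 3 < (t : ℝ)) : stretch (1, t) = 1 :=
  projIcc_of_right_le zero_le_one (by simp; linarith)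

variable {N : Type*}

/-- The coordinatewise version of `stretch` on a cube. -/
def cubeStretch (N : Type*) : C(I × (N → I), N → I) where
  toFun z i := stretch (z.1, z.2 i)
  continuous_toFun := by fun_prop

theorem cubeStretch_zero (y : N → I) : cubeStretch N (0, y) = y :=
  funext fun i => stretch_zero (y i)

theorem cubeStretch_mem_boundary (s : I) {y : N → I} (hy : y ∈ Cube.boundary N) :
    cubeStretch N (s, y) ∈ Cube.boundary N := by
  obtain ⟨i, hi | hi⟩ := hy
  · exact ⟨i, .inl (by simp [cubeStretch, hi, stretch_apply_zero])⟩
  · exact ⟨i, .inr (by simp [cubeStretch, hi, stretch_apply_one])⟩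

/-- An open neighbourhood of the boundary of a cube. -/
def cubeCollar (N : Type*) : Set (N → I) :=
  ⋃ i, {y | (y i : ℝ) < 1 / 3} ∪ {y | 2 / 3 < (y i : ℝ)}

theorem isOpen_cubeCollar : IsOpen (cubeCollar N) :=
  isOpen_iUnion fun _ => (isOpen_lt (by fun_prop) (by fun_prop)).union
    (isOpen_lt (by fun_prop) (by fun_prop))

theorem boundary_subset_cubeCollar : Cube.boundary N ⊆ cubeCollar N := by
  rintro y ⟨i, hi | hi⟩
  · exact mem_iUnion.2 ⟨i, .inl (by simp [hi])⟩
  · exact mem_iUnion.2 ⟨i, .inr (by simp [hi]; norm_num)⟩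

theorem cubeStretch_one_mem_boundary {y : N → I} (hy : y ∈ cubeCollar N) :
    cubeStretch N (1, y) ∈ Cube.boundary N := by
  obtain ⟨i, hi | hi⟩ := mem_iUnion.1 hy
  · exact ⟨i, .inl (stretch_one_of_lt hi)⟩
  · exact ⟨i, .inr (stretch_one_of_gt hi)⟩

theorem isClosed_cubeBoundary [Finite N] : IsClosed (Cube.boundary N) := by
  have : Cube.boundary N = ⋃ i, {y : N → I | y i = 0} ∪ {y | y i = 1} := by
    ext y; simp [Cube.boundary]
  rw [this]
  exact isClosed_iUnion_of_finite fun i => (isClosed_eq (by fun_prop) (by fun_prop)).union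
    (isClosed_eq (by fun_prop) (by fun_prop))

/-- The reparametrization of a loop that is constant near the boundary of the cube. -/
def stretchLoop {x : X} (q : GenLoop N X x) : GenLoop N X x :=
  ⟨q.1.comp ⟨fun y => cubeStretch N (1, y), by fun_prop⟩,
    fun _ hy => q.2 _ (cubeStretch_mem_boundary 1 hy)⟩

theorem homotopic_stretchLoop {x : X} (q : GenLoop N X x) :
    GenLoop.Homotopic q (stretchLoop q) :=
  ⟨{ toFun := fun z => q.1 (cubeStretch N z)
     continuous_toFun := by fun_prop
     map_zero_left := fun y => congrArg q.1 (cubeStretch_zero y)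
     map_one_left := fun _ => rfl
     prop' := fun s y hy =>
      (q.2 _ (cubeStretch_mem_boundary s hy)).trans (q.2 y hy).symm }⟩

/-- Gluing of two continuous maps, one near `t = 0` and the other near `t = 1`. -/
theorem continuousAt_ite_lt_half {K : Type*} [TopologicalSpace K] {a b : K → E} {τ : K → ℝ}
    (ha : Continuous a) (hb : Continuous b) (hτ : Continuous τ) {k : K}
    [DecidablePred fun k => τ k < 1 / 2]
    (hk : τ k < 1 / 2 ∨ 1 / 2 < τ k) :
    ContinuousAt (fun k => if τ k < 1 / 2 then a k else b k) k := by
  rcases hk with hk | hk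
  · exact ha.continuousAt.congr (eventually_of_mem
      ((isOpen_lt hτ continuous_const).mem_nhds hk) fun k (hk : τ k < 1 / 2) => (if_pos hk).symm)
  · exact hb.continuousAt.congr (eventually_of_mem
      ((isOpen_lt continuous_const hτ).mem_nhds hk)
      fun k (hk : 1 / 2 < τ k) => (if_neg hk.le.not_gt).symm)

/-! ### Path components and homotopy groups -/

/-- A locally shrinkable map reflects paths. -/
theorem joined_of_locally_shrinkable {p : E → X}
    (hp : ∀ x, ∃ W, IsOpen W ∧ x ∈ W ∧ IsShrinkableOver p W) {e e' : E}
    (h : Joined (p e) (p e')) : Joined e e' := by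
  classical
  obtain ⟨γ⟩ := h
  obtain ⟨h, -, hh⟩ := exists_lift_of_locally_shrinkable hp
    (g := fun t : I => γ (stretch (1, t))) (by fun_prop)
    (f := fun t : I => if (t : ℝ) < 1 / 2 then e else e')
    (V := {t | (t : ℝ) < 1 / 3} ∪ {t | 2 / 3 < (t : ℝ)}) (C := {0, 1})
    ((isOpen_lt (by fun_prop) (by fun_prop)).union (isOpen_lt (by fun_prop) (by fun_prop)))
    (Set.toFinite _).isClosed
    (by rintro t (rfl | rfl)
        · exact .inl (by simp)
        · exact .inr (by simp; norm_num))
    (fun t ht => (continuousAt_ite_lt_half continuous_const continuous_const (by fun_prop)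
      (ht.imp (fun h : (t : ℝ) < 1 / 3 => by linarith)
        (fun h : 2 / 3 < (t : ℝ) => by linarith))).continuousWithinAt)
    (by rintro t (ht | ht)
        · have ht' : (t : ℝ) < 1 / 2 := by have : (t : ℝ) < 1 / 3 := ht; linarith
          simp only [if_pos ht', stretch_one_of_lt ht, γ.source]
        · have ht' : ¬ (t : ℝ) < 1 / 2 := by have : 2 / 3 < (t : ℝ) := ht; linarith
          simp only [if_neg ht', stretch_one_of_gt ht, γ.target])
  refine ⟨⟨h, ?_, ?_⟩⟩
  · exact (hh (.inl rfl)).trans (by simp)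
  · exact (hh (.inr rfl)).trans (by norm_num)

/-- On the collar a stretched loop is constant at `p e`, so the constant map `e` lifts it there and
can be extended over the cube. -/
theorem surjective_homotopyGroupMap_of_locally_shrinkable (p : C(E, X))
    (hp : ∀ x, ∃ W, IsOpen W ∧ x ∈ W ∧ IsShrinkableOver p W) (n : ℕ) (e : E) :
    Function.Surjective (homotopyGroupMap p n e) := by
  intro q
  induction q using Quotient.inductionOn with | _ q
  obtain ⟨h, hh, hC⟩ := exists_lift_of_locally_shrinkable hp
    (g := stretchLoop q) (stretchLoop q).1.continuous (f := fun _ => e)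
    isOpen_cubeCollar isClosed_cubeBoundary boundary_subset_cubeCollar continuousOn_const
    (fun y hy => (q.2 _ (cubeStretch_one_mem_boundary hy)).symm)
  refine ⟨Quotient.mk _ ⟨h, fun y hy => hC hy⟩, Quotient.sound ?_⟩
  have : genLoopMap p n e ⟨h, fun y hy => hC hy⟩ = stretchLoop q := GenLoop.ext _ _ hh
  rw [this]
  exact (homotopic_stretchLoop q).symm

/-- The homotopy downstairs is stretched in time and in the cube, then lifted relative to the
stretched loops at the two ends and the constant `e` on the sides. -/
theorem injective_homotopyGroupMap_of_locally_shrinkable (p : C(E, X))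
    (hp : ∀ x, ∃ W, IsOpen W ∧ x ∈ W ∧ IsShrinkableOver p W) (n : ℕ) (e : E) :
    Function.Injective (homotopyGroupMap p n e) := by
  classical
  intro q₀ q₁ hq
  induction q₀ using Quotient.inductionOn with | _ q₀
  induction q₁ using Quotient.inductionOn with | _ q₁
  obtain ⟨G⟩ : GenLoop.Homotopic (genLoopMap p n e q₀) (genLoopMap p n e q₁) := Quotient.exact hq
  let B := Cube.boundary (Fin n)
  let f : I × (Fin n → I) → E := fun z =>
    if (z.1 : ℝ) < 1 / 2 then stretchLoop q₀ z.2 else stretchLoop q₁ z.2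
  let V₁ : Set (I × (Fin n → I)) := {z | (z.1 : ℝ) < 1 / 3} ∪ {z | 2 / 3 < (z.1 : ℝ)}
  let V₂ : Set (I × (Fin n → I)) := Prod.snd ⁻¹' cubeCollar (Fin n)
  have hV₁ : IsOpen V₁ :=
    (isOpen_lt (by fun_prop) (by fun_prop)).union (isOpen_lt (by fun_prop) (by fun_prop))
  have hV₂ : IsOpen V₂ := isOpen_cubeCollar.preimage continuous_snd
  have f0 : ∀ z : I × (Fin n → I), (z.1 : ℝ) < 1 / 3 → f z = stretchLoop q₀ z.2 :=
    fun z hz => if_pos (by linarith)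
  have f1 : ∀ z : I × (Fin n → I), 2 / 3 < (z.1 : ℝ) → f z = stretchLoop q₁ z.2 :=
    fun z hz => if_neg (by linarith)
  -- Both stretched loops equal `e` on the collar, so the jump of `f` at time `1/2` disappears
  -- there.
  have hfe : ∀ z ∈ V₂, f z = e := by
    intro z hz
    have h0 : stretchLoop q₀ z.2 = e := q₀.2 _ (cubeStretch_one_mem_boundary hz)
    have h1 : stretchLoop q₁ z.2 = e := q₁.2 _ (cubeStretch_one_mem_boundary hz)
    simp [f, h0, h1]
  obtain ⟨h, -, hC⟩ := exists_lift_of_locally_shrinkable hp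
    (g := fun z : I × (Fin n → I) => G (stretch (1, z.1), cubeStretch (Fin n) (1, z.2)))
    (by fun_prop) (f := f) (V := V₁ ∪ V₂)
    (C := ({z | z.1 = 0} ∪ {z | z.1 = 1}) ∪ Prod.snd ⁻¹' B) (hV₁.union hV₂)
    (((isClosed_eq (by fun_prop) (by fun_prop)).union
      (isClosed_eq (by fun_prop) (by fun_prop))).union
      (isClosed_cubeBoundary.preimage continuous_snd))
    (by rintro ⟨t, y⟩ ((rfl | rfl) | hz)
        · exact .inl (.inl (by simp))
        · exact .inl (.inr (by simp; norm_num))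
        · exact .inr (boundary_subset_cubeCollar hz))
    (by rintro z (hz | hz)
        · exact (continuousAt_ite_lt_half
            ((stretchLoop q₀).1.continuous.comp continuous_snd)
            ((stretchLoop q₁).1.continuous.comp continuous_snd) (by fun_prop)
            (hz.imp (fun h : (z.1 : ℝ) < 1 / 3 => by linarith)
              (fun h : 2 / 3 < (z.1 : ℝ) => by linarith))).continuousWithinAt
        · exact (continuousAt_const.congr
            (eventually_of_mem (hV₂.mem_nhds hz) fun z hz => (hfe z hz).symm)).continuousWithinAt)
    (by rintro z ((hz | hz) | hz)
        · rw [f0 z hz, stretch_one_of_lt hz]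
          exact (G.apply_zero _).symm
        · rw [f1 z hz, stretch_one_of_gt hz]
          exact (G.apply_one _).symm
        · rw [hfe z hz]
          have hb := cubeStretch_one_mem_boundary hz
          exact ((G.eq_fst _ hb).trans ((genLoopMap p n e q₀).2 _ hb)).symm)
  have main : GenLoop.Homotopic (stretchLoop q₀) (stretchLoop q₁) :=
    ⟨{ toFun := h
       continuous_toFun := h.continuous
       map_zero_left := fun y => (hC (.inl (.inl rfl))).trans (f0 (0, y) (by simp))
       map_one_left := fun y => (hC (.inl (.inr rfl))).trans (f1 (1, y) (by simp; norm_num))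
       prop' := fun t y hy => ((hC (x := (t, y)) (.inr hy)).trans
          (hfe _ (boundary_subset_cubeCollar hy))).trans ((stretchLoop q₀).2 y hy).symm }⟩
  exact Quotient.sound
    (((homotopic_stretchLoop q₀).trans main).trans (homotopic_stretchLoop q₁).symm)

/-- A locally shrinkable map is a weak equivalence. -/
theorem isWeakEquivalence_of_locally_shrinkable (p : C(E, X))
    (hp : ∀ x, ∃ W, IsOpen W ∧ x ∈ W ∧ IsShrinkableOver p W) : IsWeakEquivalence p := by
  refine ⟨⟨fun a b hab => ?_, fun x => ?_⟩, fun n _ e =>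
    ⟨injective_homotopyGroupMap_of_locally_shrinkable p hp n e,
      surjective_homotopyGroupMap_of_locally_shrinkable p hp n e⟩⟩
  · induction a using Quotient.inductionOn with | _ a
    induction b using Quotient.inductionOn with | _ b
    exact Quotient.sound (joined_of_locally_shrinkable hp (Quotient.exact hab))
  · induction x using Quotient.inductionOn with | _ x
    obtain ⟨W, -, hxW, s, -, -, -, hs, -⟩ := hp x
    exact ⟨ZerothHomotopy.mk (s x), congrArg ZerothHomotopy.mk (hs x hxW)⟩

end Shrinkable

/-! ### The projection of the Čech complex is shrinkable over each member of the cover -/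

section CechContraction

open Set unitInterval

/-- The point of `Δ^{n+1}` on the segment from the image of `t ∈ Δ^n` in the face opposite to the
zeroth vertex (for `s = 0`) to the zeroth vertex (for `s = 1`). -/
def simplexCone {n : ℕ} (s : I) (t : stdSimplex ℝ (Fin (n + 1))) :
    stdSimplex ℝ (Fin (n + 1 + 1)) :=
  ⟨(s : ℝ) • (stdSimplex.vertex (S := ℝ) (0 : Fin (n + 1 + 1))).1 +
      (1 - s : ℝ) • (stdSimplex.map Fin.succ t).1,
    convex_stdSimplex ℝ _ (stdSimplex.vertex (S := ℝ) (0 : Fin (n + 1 + 1))).2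
      (stdSimplex.map Fin.succ t).2 s.2.1 (sub_nonneg.2 s.2.2) (by ring)⟩

theorem continuous_simplexCone {n : ℕ} :
    Continuous fun z : I × stdSimplex ℝ (Fin (n + 1)) => simplexCone z.1 z.2 := by
  have h : Continuous fun z : I × stdSimplex ℝ (Fin (n + 1)) =>
      (stdSimplex.map (Fin.succ : Fin (n + 1) → Fin (n + 1 + 1)) z.2).1 :=
    continuous_subtype_val.comp ((stdSimplex.continuous_map _).comp continuous_snd)
  exact Continuous.subtype_mk (by fun_prop) _

theorem simplexCone_zero {n : ℕ} (t : stdSimplex ℝ (Fin (n + 1))) :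
    simplexCone 0 t = stdSimplex.map Fin.succ t :=
  Subtype.ext (by simp [simplexCone])

theorem simplexCone_one {n : ℕ} (t : stdSimplex ℝ (Fin (n + 1))) :
    simplexCone 1 t = stdSimplex.vertex 0 :=
  Subtype.ext (by simp [simplexCone])

/-- The extension of a monotone map `[m] → [n]` to `[m+1] → [n+1]` that fixes `0`. -/
def consHom {m n : SimplexCategory} (θ : m ⟶ n) :
    SimplexCategory.mk (m.len + 1) ⟶ SimplexCategory.mk (n.len + 1) :=
  SimplexCategory.Hom.mk ⟨Fin.cons 0 fun i => (θ.toOrderHom i).succ, by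
    intro i j hij
    induction i using Fin.cases with
    | zero => exact Fin.zero_le _
    | succ i =>
      induction j using Fin.cases with
      | zero => exact absurd hij (by simp)
      | succ j =>
        simpa using θ.toOrderHom.monotone (Fin.succ_le_succ_iff.1 hij)⟩

/-- The monotone map `[n] → [n+1]` that omits `0`. -/
def succHom (n : SimplexCategory) : n ⟶ SimplexCategory.mk (n.len + 1) :=
  SimplexCategory.Hom.mk (Fin.succOrderEmb _).toOrderHom

/-- The monotone map `[0] → [n]` with value `0`. -/
def zeroHom (n : ℕ) : SimplexCategory.mk 0 ⟶ SimplexCategory.mk n :=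
  SimplexCategory.Hom.mk ⟨fun _ => 0, fun _ _ _ => le_rfl⟩

/-- Both sides are affine along cone lines, so it suffices to compare the cone vertex and the
opposite face. This naturality makes coning compatible with the gluing relation. -/
theorem map_consHom_simplexCone {m n : SimplexCategory} (θ : m ⟶ n) (s : I)
    (t : stdSimplex ℝ (Fin (m.len + 1))) :
    stdSimplex.map (consHom θ).toOrderHom (simplexCone s t) =
      simplexCone s (stdSimplex.map θ.toOrderHom t) := by
  have h1 : stdSimplex.map (S := ℝ) (consHom θ).toOrderHom (stdSimplex.vertex 0) =
      stdSimplex.vertex 0 := stdSimplex.map_vertex _ _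
  have h2 : stdSimplex.map (consHom θ).toOrderHom (stdSimplex.map Fin.succ t) =
      stdSimplex.map Fin.succ (stdSimplex.map θ.toOrderHom t) := by
    rw [stdSimplex.map_comp_apply, stdSimplex.map_comp_apply]
    rfl
  apply Subtype.ext
  change FunOnFinite.linearMap ℝ ℝ _ (_ + _) = _ + _
  rw [map_add, map_smul, map_smul]
  exact congrArg₂ (fun a b => (s : ℝ) • a + (1 - s : ℝ) • b) (congrArg Subtype.val h1)
    (congrArg Subtype.val h2)

theorem mem_iInter_cons {X : Type u} {A : Type v} (U : A → Set X) {n : ℕ} {a : A}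
    {α : Fin n → A} {x : X} (ha : x ∈ U a)
    (hα : x ∈ ⋂ i, U (α i)) : x ∈ ⋂ i, U ((Fin.cons a α : Fin (n + 1) → A) i) :=
  mem_iInter.2 (Fin.cases ha (mem_iInter.1 hα))

/-! ### The fibrewise cone on the realization -/

variable {X : Type u} [TopologicalSpace X] {A : Type v} (U : A → Set X)

/-- The point of the realization of the Čech complex represented by `x ∈ U_{a_0 ⋯ a_n}` and
`t ∈ Δ^n`. -/
def cechPoint (n : SimplexCategory) (α : Fin (n.len + 1) → A) (x : (⋂ i, U (α i) : Set X))
    (t : stdSimplex ℝ (Fin (n.len + 1))) : Realization (cechComplex U) :=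
  Quot.mk _ ⟨n, ((⟨α, x⟩ : CechLevel U n), t)⟩

theorem cechPoint_map {m n : SimplexCategory} (θ : m ⟶ n) (α : Fin (n.len + 1) → A)
    (x : (⋂ i, U (α i) : Set X)) (t : stdSimplex ℝ (Fin (m.len + 1))) :
    cechPoint U n α x (stdSimplex.map θ.toOrderHom t) =
      cechPoint U m (α ∘ θ.toOrderHom)
        ⟨x.1, mem_iInter.2 fun i => mem_iInter.1 x.2 (θ.toOrderHom i)⟩ t :=
  (Quot.sound (RealizationRel.glue (S := cechComplex U) θ (⟨α, x⟩ : CechLevel U n) t)).symm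

theorem continuous_cechPoint (n : SimplexCategory) (α : Fin (n.len + 1) → A) :
    Continuous fun z : (⋂ i, U (α i) : Set X) × stdSimplex ℝ (Fin (n.len + 1)) =>
      cechPoint U n α z.1 z.2 :=
  continuous_quot_mk.comp <| (@continuous_sigmaMk _
    (fun n : SimplexCategory => CechLevel U n × stdSimplex ℝ (Fin (n.len + 1))) _ n).comp <|
    ((@continuous_sigmaMk _ (fun b : Fin (n.len + 1) → A => (⋂ i, U (b i) : Set X)) _ α).comp
      continuous_fst).prodMk continuous_snd

theorem cechPoint_congr {n : SimplexCategory} {α β : Fin (n.len + 1) → A} (h : α = β) {x : X}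
    (hα : x ∈ ⋂ i, U (α i)) (hβ : x ∈ ⋂ i, U (β i)) (t : stdSimplex ℝ (Fin (n.len + 1))) :
    cechPoint U n α ⟨x, hα⟩ t = cechPoint U n β ⟨x, hβ⟩ t := by
  subst h
  rfl

open Classical in
/-- The contraction of the realization of the Čech complex over `U a`, on representatives: it
prepends the index `a`. -/
def cechConePre (a : A) (s : I) (p : PreRealization (cechComplex U)) :
    Realization (cechComplex U) :=
  if h : ((p.2.1 : CechLevel U p.1).2 : X) ∈ U a then
    cechPoint U (SimplexCategory.mk (p.1.len + 1)) (Fin.cons a (p.2.1 : CechLevel U p.1).1)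
      ⟨_, mem_iInter_cons U h (p.2.1 : CechLevel U p.1).2.2⟩ (simplexCone s p.2.2)
  -- Default value: only points over `U a` matter, and the identity respects the gluing.
  else Quot.mk _ p

/-- The contraction of the realization of the Čech complex over `U a`. -/
def cechCone (a : A) (z : Realization (cechComplex U) × I) : Realization (cechComplex U) :=
  Quot.lift (cechConePre U a z.2) (by
    rintro _ _ ⟨θ, ⟨α, x⟩, t⟩
    by_cases h : (x : X) ∈ U a
    · refine (dif_pos h).trans (Eq.trans ?_ (dif_pos h).symm)
      dsimp only
      rw [← map_consHom_simplexCone, cechPoint_map U (consHom θ)]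
      exact (cechPoint_congr U (funext (Fin.cases rfl fun _ => rfl)) _ _ _).symm
    · refine (dif_neg h).trans (Eq.trans ?_ (dif_neg h).symm)
      exact Quot.sound (RealizationRel.glue θ _ t)) z.1

theorem cechCone_cechPoint {a : A} (n : SimplexCategory) (α : Fin (n.len + 1) → A)
    (x : (⋂ i, U (α i) : Set X)) (t : stdSimplex ℝ (Fin (n.len + 1))) (s : I)
    (h : (x : X) ∈ U a) :
    cechCone U a (cechPoint U n α x t, s) =
      cechPoint U (SimplexCategory.mk (n.len + 1)) (Fin.cons a α)
        ⟨x, mem_iInter_cons U h x.2⟩ (simplexCone s t) :=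
  dif_pos h

theorem exists_eq_cechPoint (e : Realization (cechComplex U)) :
    ∃ n α x t, e = cechPoint U n α x t := by
  obtain ⟨⟨n, ⟨⟨α, x⟩, t⟩⟩, rfl⟩ := Quot.exists_rep e
  exact ⟨n, α, x, t, rfl⟩

/-- The point of the realization of the Čech complex given by the vertex `a` over `x ∈ U a`. -/
def cechVertex (a : A) (x : U a) : Realization (cechComplex U) :=
  cechPoint U (SimplexCategory.mk 0) (fun _ => a) ⟨x, mem_iInter.2 fun _ => x.2⟩
    (stdSimplex.vertex 0)

theorem continuous_cechVertex (a : A) : Continuous (cechVertex U a) :=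
  (continuous_cechPoint U (SimplexCategory.mk 0) fun _ => a).comp
    ((continuous_subtype_val.subtype_mk _).prodMk continuous_const)

theorem continuousOn_cechConePre {a : A} (ha : IsOpen (U a)) :
    ContinuousOn (fun z : PreRealization (cechComplex U) × I => cechConePre U a z.2 z.1)
      {z | cechProjection U (Quot.mk _ z.1) ∈ U a} := by
  rintro ⟨⟨n, ⟨⟨α, x⟩, t⟩⟩, s⟩ (hx : (x : X) ∈ U a)
  apply ContinuousAt.continuousWithinAt
  let j : ((⋂ i, U (α i) : Set X) × stdSimplex ℝ (Fin (n.len + 1))) × I →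
      (Σ n : SimplexCategory, CechLevel U n × stdSimplex ℝ (Fin (n.len + 1))) × I :=
    Prod.map (Sigma.mk n ∘
      Prod.map (@Sigma.mk _ (fun b : Fin (n.len + 1) → A => (⋂ i, U (b i) : Set X)) α) id) id
  have hj : IsOpenEmbedding j :=
    -- Each summand is open in the coproduct, so continuity can be checked for one fixed index
    -- tuple, where the cone is given by a single formula.
    (IsOpenEmbedding.sigmaMk.comp (IsOpenEmbedding.sigmaMk.prodMap .id)).prodMap .id
  refine (hj.continuousAt_iff (x := ((x, t), s))).1 ?_
  let S : Set (((⋂ i, U (α i) : Set X) × stdSimplex ℝ (Fin (n.len + 1))) × I) :=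
    {z | (z.1.1 : X) ∈ U a}
  have hS : IsOpen S := ha.preimage (by fun_prop)
  refine ContinuousOn.continuousAt (s := S) ?_ (hS.mem_nhds hx)
  rw [continuousOn_iff_continuous_domRestrict]
  have : Continuous fun z : S =>
      cechPoint U (SimplexCategory.mk (n.len + 1)) (Fin.cons a α)
        ⟨z.1.1.1, mem_iInter_cons U z.2 z.1.1.1.2⟩ (simplexCone z.1.2 z.1.1.2) :=
    (continuous_cechPoint U (SimplexCategory.mk (n.len + 1)) (Fin.cons a α)).comp
      (Continuous.prodMk (Continuous.subtype_mk (by fun_prop) _)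
        (continuous_simplexCone.comp (f := fun z : S => (z.1.2, z.1.1.2)) (by fun_prop)))
  refine this.congr fun z => ?_
  have hz : (z.1.1.1 : X) ∈ U a := z.2
  exact (cechCone_cechPoint U n α z.1.1.1 z.1.1.2 z.1.2 hz).symm

/-- Openness of `U a` keeps the restricted projection from representatives a quotient map, and local
compactness of `I` lets continuity descend along its product with `I`. -/
theorem continuousOn_cechCone {a : A} (ha : IsOpen (U a)) :
    ContinuousOn (cechCone U a) ((cechProjection U ⁻¹' U a) ×ˢ univ) := by
  have hq : IsQuotientMap
      (Quot.mk _ : PreRealization (cechComplex U) → Realization (cechComplex U)) :=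
    isQuotientMap_quot_mk
  have hq' := hq.restrictPreimage_isOpen (ha.preimage (cechProjection U).continuous)
  have h : Continuous fun z : (cechProjection U ⁻¹' U a) × I => cechCone U a (z.1.1, z.2) := by
    refine hq'.continuous_lift_prod_left ?_
    exact (continuousOn_cechConePre U ha).comp_continuous
      (f := fun z : (Quot.mk _ ⁻¹' (cechProjection U ⁻¹' U a) :
        Set (PreRealization (cechComplex U))) × I => (z.1.1, z.2))
      (by fun_prop) fun z => z.1.2
  rw [continuousOn_iff_continuous_domRestrict]
  exact h.comp (f := fun z : ((cechProjection U ⁻¹' U a) ×ˢ univ :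
    Set (Realization (cechComplex U) × I)) => (⟨z.1.1, z.2.1⟩, z.1.2)) (by fun_prop)

/-- The projection of the realization of the Čech complex is shrinkable over each member of the
cover. -/
theorem isShrinkableOver_cechProjection (hcover : ⋃ a, U a = univ) {a : A} (ha : IsOpen (U a)) :
    IsShrinkableOver (cechProjection U) (U a) := by
  classical
  have hc : ∀ x, ∃ b, x ∈ U b := fun x => mem_iUnion.1 (hcover ▸ mem_univ x)
  -- Off `U a` the value is arbitrary; the cover serves only to supply some point there.
  let sec : X → Realization (cechComplex U) := fun x =>
    if h : x ∈ U a then cechVertex U a ⟨x, h⟩ else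
      cechVertex U (hc x).choose ⟨x, (hc x).choose_spec⟩
  have hsec : ∀ x (h : x ∈ U a), sec x = cechVertex U a ⟨x, h⟩ := fun x h => dif_pos h
  refine ⟨sec, cechCone U a, ?_, continuousOn_cechCone U ha, ?_, ?_, ?_, ?_⟩
  · rw [continuousOn_iff_continuous_domRestrict]
    exact (continuous_cechVertex U a).congr fun x => (hsec x x.2).symm
  · intro x hx
    rw [hsec x hx]
    rfl
  · intro e s he
    obtain ⟨n, α, x, t, rfl⟩ := exists_eq_cechPoint U e
    rw [cechCone_cechPoint U n α x t s he]
    rfl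
  · intro e he
    obtain ⟨n, α, x, t, rfl⟩ := exists_eq_cechPoint U e
    rw [cechCone_cechPoint U n α x t 0 he, simplexCone_zero]
    -- At time `0` the point lies in the face opposite the new vertex, so gluing along `succHom`
    -- deletes `a` again.
    exact cechPoint_map U (succHom n) (Fin.cons a α) ⟨x, mem_iInter_cons U he x.2⟩ t
  · intro e he
    obtain ⟨n, α, x, t, rfl⟩ := exists_eq_cechPoint U e
    rw [cechCone_cechPoint U n α x t 1 he, simplexCone_one, hsec _ he]
    -- At time `1` only the vertex `a` carries weight, so gluing along `zeroHom` forgets `α`.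
    have := cechPoint_map U (zeroHom (n.len + 1)) (Fin.cons a α) ⟨x, mem_iInter_cons U he x.2⟩
      (stdSimplex.vertex 0)
    rw [stdSimplex.map_vertex] at this
    exact this

end CechContraction

end

theorem mainTheorem3 {X : Type u} [TopologicalSpace X] {A : Type v} (U : A → Set X)
    (hopen : ∀ a, IsOpen (U a)) (hcover : ⋃ a, U a = Set.univ) :
    IsWeakEquivalence (cechProjection U) :=
  isWeakEquivalence_of_locally_shrinkable _ fun x =>
    let ⟨a, ha⟩ := Set.mem_iUnion.1 (hcover ▸ Set.mem_univ x)
    ⟨U a, hopen a, ha, isShrinkableOver_cechProjection U hcover (hopen a)⟩
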